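/- \textbf{Setting.} Signals are discrete-time signals $x=(x_t)_{t\in\mathbb T}$, where the time set $\mathbb T$ is a linearly ordered, locally finite set (for instance $\mathbb T=\mathbb N$ or $\mathbb T=\mathbb Z$), with values in a real normed space (for instance $\mathbb R^m$). For $p\in[1,\infty]$ write $\|x\|_p=(\sum_t\|x_t\|^p)^{1/p}$ (with the supremum of $\|x_t\|$ if $p=\infty$), allowing the value $\infty$. Let $P_T$ be truncation, $(P_Tx)_t=x_t$ for $t\le T$ and $0$ for $t>T$, and let $\ell_{p,e}(E)$ be the space of $E$-valued signals $x$ with $\|P_Tx\|_p<\infty$ for all $T$. A system $F$ is causal if $P_TF=P_TFP_T$ for all $T$. The incremental gain $\gamma^{inc}_{r,s}(F)\in[0,\infty]$ of a system $F$ with inputs in $\ell_{r,e}(E)$ is the smallest $\gamma\in[0,\infty)$ such that $\|P_TFu-P_TFu'\|_s\le\gamma\|P_Tu-P_Tu'\|_r$ for all $u,u'\in\ell_{r,e}(E)$ and all $T$, and $\infty$ if there is none. \textbf{Privacy.} Let $(\Omega,\mathcal F,\mathbb P)$ be a probability space, let $\mathsf D$ be a set with a binary relation $\mathrm{Adj}$,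 and let $(\mathsf R,\mathcal M)$ be a measurable space. A mechanism $M:\mathsf D\times\Omega\to\mathsf R$ (with $M(d)=M(d,\cdot)$ measurable for each $d$) is $(\epsilon,\delta)$-differentially private if for all $d,d'$ with $\mathrm{Adj}(d,d')$ there is a positive measure $\mu$ on $\mathsf R$ with $\mu(\mathsf R)\le\delta$ such that $\mathbb P(M(d)\in S)\le e^{\epsilon}\,\mathbb P(M(d')\in S)+\mu(S)$ for all $S\in\mathcal M$. (Equivalently, $\mathbb P(M(d)\in S)\le e^{\epsilon}\,\mathbb P(M(d')\in S)+\delta$ for all adjacent $d,d'$ and all $S\in\mathcal M$.) For $\epsilon>0$ and $0<\delta<1$ put \[\kappa(\delta,\epsilon)=\frac{1}{2\epsilon}\Bigl(K+\sqrt{K^2+2\epsilon}\Bigr),\qquad K=\mathcal Q^{-1}(\delta),\qquad \mathcal Q(x)=\frac{1}{\sqrt{2\pi}}\int_x^\infty e^{-u^2/2}\,du .\] \textbf{Theorem.} Let $\epsilon>0$, $0<\delta<1$, let $r_1,\dots,r_n,s\in[1,\infty]$ and $b_1,\dots,b_n\ge 0$, let $E_1,\dots,E_n$ be real normed spaces (for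 instance $E_i=\mathbb R^{m_i}$ with any norm), and let $\mathbb R^{m'}$ carry the Euclidean norm. Let $\mathcal G_i:\ell_{r_i,e}(E_i)\to\ell_{s,e}(\mathbb R^{m'})$, $1\le i\le n$, be causal systems and let $\mathcal G(u_1,\dots,u_n)=\sum_{i=1}^n\mathcal G_iu_i$. On $\ell_{r_1,e}(E_1)\times\dots\times\ell_{r_n,e}(E_n)$ let $\mathrm{Adj}^b(u,u')$ hold iff for some $i$ one has $\|u_i-u_i'\|_{r_i}\le b_i$ and $u_j=u'_j$ for all $j\ne i$. Let $w=(w_t)_{t\in\mathbb T}$ be white Gaussian noise, that is, the $w_t$ are independent with $w_t\sim\mathcal N(0,\sigma^2I_{m'})$, where $\sigma\ge0$ and \[\sigma\ \ge\ \kappa(\delta,\epsilon)\,\max_{1\le i\le n}\bigl\{\gamma^{inc}_{r_i,2}(\mathcal G_i)\,b_i\bigr\}\] (with $\infty\cdot0=0$). Then the mechanism $Mu=\mathcal Gu+w$, with values in the space $(\mathbb R^{m'})^{\mathbb T}$ of all output signals with the product $\sigma$-algebra, is $(\epsilon,\delta)$-differentially private for $\mathrm{Adj}^b$. -/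

import Mathlib

open MeasureTheory ProbabilityTheory
open scoped ENNReal NNReal

noncomputable section

namespace DynamicPrivacy

/-! ### Signals, extended `ℓ_p` spaces and causal systems

Signals are functions on a discrete linearly ordered time set `𝕋` (for instance `ℕ` or `ℤ`). -/

section Signals

variable {𝕋 E F : Type*} [LinearOrder 𝕋] [NormedAddCommGroup E] [NormedAddCommGroup F]

/-- The truncation operator `P_T` on signals. -/
def truncate (T : 𝕋) (x : 𝕋 → E) : 𝕋 → E := fun t => if t ≤ T then x t else 0

/-- The `ℓ_p` norm (`0 < p ≤ ∞`) of a signal, equal to `∞` if the signal is not in `ℓ_p`. -/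
def lNorm {𝕋 E : Type*} [NormedAddCommGroup E] (p : ℝ≥0∞) (x : 𝕋 → E) : ℝ≥0∞ :=
  if p = ∞ then ⨆ t, ‖x t‖ₑ else (∑' t, ‖x t‖ₑ ^ p.toReal) ^ (1 / p.toReal)

/-- A signal has finite `ℓ_p` norm iff it belongs to `ℓ_p`. -/
theorem lNorm_lt_top_iff {𝕋 E : Type*} [NormedAddCommGroup E] {p : ℝ≥0∞} (hp : p ≠ 0)
    (x : 𝕋 → E) : lNorm p x < ∞ ↔ Memℓp x p := by
  by_cases h : p = ∞
  · subst h
    rw [memℓp_infty_iff, lNorm, if_pos rfl]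
    have := ENNReal.iSup_coe_lt_top (f := fun t => ‖x t‖₊)
    simp only [enorm_eq_nnnorm]
    rw [this, ← NNReal.bddAbove_coe, ← Set.range_comp]
    rfl
  · have hp' : 0 < p.toReal := ENNReal.toReal_pos hp h
    rw [memℓp_gen_iff hp', lNorm, if_neg h, ENNReal.rpow_lt_top_iff_of_pos (by positivity),
      lt_top_iff_ne_top]
    have : ∀ t, ‖x t‖ₑ ^ p.toReal = ((‖x t‖₊ ^ p.toReal : ℝ≥0) : ℝ≥0∞) := fun t => by
      rw [enorm_eq_nnnorm, ENNReal.coe_rpow_of_nonneg _ hp'.le]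
    simp_rw [this]
    rw [ENNReal.tsum_coe_ne_top_iff_summable, ← NNReal.summable_coe]
    simp

variable (𝕋 E) in
/-- The extended space `ℓ_{p,e}`: all signals `x` such that `P_T x ∈ ℓ_p` for every time `T`. -/
def extSpace (p : ℝ≥0∞) : AddSubgroup (𝕋 → E) where
  carrier := {x | ∀ T, Memℓp (truncate T x) p}
  zero_mem' T := by
    have : truncate T (0 : 𝕋 → E) = 0 := by funext t; simp [truncate]
    rw [this]; exact zero_memℓp
  add_mem' {x y} hx hy T := by
    have : truncate T (x + y) = truncate T x + truncate T y := by
      funext t; by_cases h : t ≤ T <;> simp [truncate, h]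
    rw [this]; exact (hx T).add (hy T)
  neg_mem' {x} hx T := by
    have : truncate T (-x) = -truncate T x := by
      funext t; by_cases h : t ≤ T <;> simp [truncate, h]
    rw [this]; exact (hx T).neg

theorem truncate_truncate (S T : 𝕋) (x : 𝕋 → E) :
    truncate S (truncate T x) = truncate (min S T) x := by
  funext t
  by_cases h : t ≤ S <;> by_cases h' : t ≤ T <;> simp [truncate, h, h']

/-- The truncation operator `P_T` as a map of `ℓ_{p,e}` to itself. -/
def extTruncate {p : ℝ≥0∞} (T : 𝕋) (x : extSpace 𝕋 E p) : extSpace 𝕋 E p :=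
  ⟨truncate T x, fun S => by rw [truncate_truncate]; exact x.2 _⟩

/-- A system `G` is causal if `P_T G = P_T G P_T` for every time `T`. -/
def IsCausal {p q : ℝ≥0∞} (G : extSpace 𝕋 E p → extSpace 𝕋 F q) : Prop :=
  ∀ T u, extTruncate T (G u) = extTruncate T (G (extTruncate T u))

/-- The `ℓ_r`-to-`ℓ_s` incremental gain of a system: the smallest `γ ≥ 0` with
`‖P_T G u - P_T G u'‖_s ≤ γ ‖P_T u - P_T u'‖_r` for all times `T` and all inputs `u, u'`;
it is `∞` if there is no such real number. -/
def incGain {r q : ℝ≥0∞} (s : ℝ≥0∞) (G : extSpace 𝕋 E r → extSpace 𝕋 F q) : ℝ≥0∞ :=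
  ⨅ (γ : ℝ≥0) (_ : ∀ T u u', lNorm s (truncate T (G u : 𝕋 → F) - truncate T (G u' : 𝕋 → F)) ≤
      γ * lNorm r (truncate T (u : 𝕋 → E) - truncate T (u' : 𝕋 → E))), (γ : ℝ≥0∞)

end Signals

/-- The adjacency relation `Adj^b` on `ℓ_{r_1,e} × ⋯ × ℓ_{r_n,e}`: for some participant `i`,
`‖u_i - u'_i‖_{r_i} ≤ b_i`, and `u_j = u'_j` for all `j ≠ i`. -/
def SignalAdj {𝕋 : Type*} [LinearOrder 𝕋] {n : ℕ} {E : Fin n → Type*}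
    [∀ i, NormedAddCommGroup (E i)] {r : Fin n → ℝ≥0∞} (b : Fin n → ℝ≥0)
    (u u' : ∀ i, extSpace 𝕋 (E i) (r i)) : Prop :=
  ∃ i, lNorm (r i) ((u i : 𝕋 → E i) - (u' i : 𝕋 → E i)) ≤ b i ∧ ∀ j, j ≠ i → u j = u' j

/-! ### Differential privacy -/

/-- A mechanism `M : D × Ω → R`, measurable in `ω` for each dataset, is
`(ε, δ)`-differentially private if for all adjacent `d, d'` there is a measure `μ` on `R` of
total mass at most `δ` such that `ℙ(M(d) ∈ S) ≤ exp ε * ℙ(M(d') ∈ S) + μ(S)` for all measurable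
sets `S`. -/
structure IsDifferentiallyPrivate {Ω D R : Type*} [MeasurableSpace Ω] [MeasurableSpace R]
    (P : Measure Ω) (Adj : D → D → Prop) (ε δ : ℝ) (M : D → Ω → R) : Prop where
  measurable : ∀ d, Measurable (M d)
  bound : ∀ d d', Adj d d' → ∃ μ : Measure R, μ Set.univ ≤ ENNReal.ofReal δ ∧
    ∀ S, MeasurableSet S →
      P (M d ⁻¹' S) ≤ ENNReal.ofReal (Real.exp ε) * P (M d' ⁻¹' S) + μ S

/-- White Gaussian noise with `w_t ∼ N(0, σ² I_k)`: the `w_t` are independent random vectors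
with this law. -/
structure IsWhiteGaussianNoise {Ω 𝕋 : Type*} [MeasurableSpace Ω] (P : Measure Ω) {k : ℕ}
    (σ : ℝ≥0) (w : 𝕋 → Ω → EuclideanSpace ℝ (Fin k)) : Prop where
  measurable : ∀ t, Measurable (w t)
  indep : iIndepFun w P
  law : ∀ t, P.map (w t) = multivariateGaussian 0 ((σ : ℝ) ^ 2 • (1 : Matrix (Fin k) (Fin k) ℝ))

/-- The Gaussian tail function `Q(x) = (2π)^{-1/2} ∫_x^∞ exp(-u²/2) du`. -/
def gaussianQ (x : ℝ) : ℝ := 1 / √(2 * Real.pi) * ∫ u in Set.Ioi x, Real.exp (-u ^ 2 / 2)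

/-- The inverse of the bijection `gaussianQ : ℝ → (0, 1)`, used only at points of `(0, 1)`. -/
def gaussianQInv : ℝ → ℝ := Function.invFun gaussianQ

/-- `κ(δ, ε) = (K + √(K² + 2ε)) / (2ε)` with `K = Q⁻¹(δ)`. -/
def kappa (δ ε : ℝ) : ℝ :=
  1 / (2 * ε) * (gaussianQInv δ + √(gaussianQInv δ ^ 2 + 2 * ε))

/-- The dynamic Gaussian mechanism `M u = (∑ i, G_i u_i) + w`, with values in the space of all
signals (with the product σ-algebra). -/
def gaussianMechanism {Ω 𝕋 : Type*} [LinearOrder 𝕋] {n k : ℕ} {E : Fin n → Type*}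
    [∀ i, NormedAddCommGroup (E i)] {r : Fin n → ℝ≥0∞} {s : ℝ≥0∞}
    (G : ∀ i, extSpace 𝕋 (E i) (r i) → extSpace 𝕋 (EuclideanSpace ℝ (Fin k)) s)
    (w : 𝕋 → Ω → EuclideanSpace ℝ (Fin k)) (u : ∀ i, extSpace 𝕋 (E i) (r i)) (ω : Ω) :
    𝕋 → EuclideanSpace ℝ (Fin k) :=
  fun t => (∑ i, G i (u i) : extSpace 𝕋 (EuclideanSpace ℝ (Fin k)) s).1 t + w t ω

end DynamicPrivacy

end

/-! ### One-dimensional Gaussian estimate. -/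

section
open DynamicPrivacy Filter Topology

/-! On a finite window of times the noise is an isotropic Gaussian vector, and adjacent inputs shift
its mean by some `v` with `‖v‖ ≤ γ b`, where `γ` is the gain of the one system whose input changes.
The component orthogonal to `v` has the same law under both inputs, so all reduces to comparing N(D,
σ²) with N(0, σ²) on the line, D = ‖v‖ (`map_add_le_exp_smul_add`). There the density ratio exceeds
e^ε only on a tail, whose mass is at most δ because σ/D ≥ κ (`gaussianReal_le_exp_smul_add`).

The bound passes from windows to whole signals because cylinders are dense among measurable sets; a
Hahn decomposition then supplies the measure μ (`exists_measure_le_smul_add_of_cylinder`). -/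

theorem gaussianQ_eq_measureReal_Ioi (x : ℝ) : gaussianQ x = (gaussianReal 0 1).real (Set.Ioi x) := by
  rw [measureReal_def, gaussianReal_apply_eq_integral _ one_ne_zero, ENNReal.toReal_ofReal
    (integral_nonneg fun _ => gaussianPDFReal_nonneg _ _ _), gaussianQ, ← integral_const_mul]
  simp [gaussianPDFReal]

theorem ofReal_gaussianQ (x : ℝ) : ENNReal.ofReal (gaussianQ x) = gaussianReal 0 1 (Set.Ioi x) := by
  rw [gaussianQ_eq_measureReal_Ioi, ofReal_measureReal]

theorem gaussianQ_antitone : Antitone gaussianQ := fun x y h => by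
  rw [gaussianQ_eq_measureReal_Ioi, gaussianQ_eq_measureReal_Ioi]
  exact measureReal_mono (Set.Ioi_subset_Ioi h)

theorem gaussianQ_eq_one_sub_cdf (x : ℝ) : gaussianQ x = 1 - cdf (gaussianReal 0 1) x := by
  rw [gaussianQ_eq_measureReal_Ioi, cdf_eq_real, ← Set.compl_Iic,
    probReal_compl_eq_one_sub measurableSet_Iic]

theorem continuous_cdf_of_nullSingletonClass (μ : Measure ℝ) [IsProbabilityMeasure μ]
    [NullSingletonClass μ] : Continuous (cdf μ) := by
  refine continuous_iff_continuousAt.2 fun x => ?_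
  rw [(monotone_cdf μ).continuousAt_iff_leftLim_eq_rightLim, StieltjesFunction.rightLim_eq]
  have h := (cdf μ).measure_singleton x
  rw [measure_cdf, measure_singleton, eq_comm, ENNReal.ofReal_eq_zero] at h
  exact le_antisymm ((monotone_cdf μ).leftLim_le le_rfl) (by linarith)

theorem gaussianQ_gaussianQInv {δ : ℝ} (h₀ : 0 < δ) (h₁ : δ < 1) :
    gaussianQ (gaussianQInv δ) = δ := by
  have : NullSingletonClass (gaussianReal 0 1) := nullSingletonClass_gaussianReal one_ne_zero
  obtain ⟨x, hx⟩ : (1 - δ) ∈ Set.range (cdf (gaussianReal 0 1)) :=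
    mem_range_of_exists_le_of_exists_ge (continuous_cdf_of_nullSingletonClass _)
      (((tendsto_cdf_atBot _).eventually_le_const (by linarith)).exists)
      (((tendsto_cdf_atTop _).eventually_const_le (by linarith)).exists)
  exact Function.invFun_eq ⟨x, by rw [gaussianQ_eq_one_sub_cdf, hx]; ring⟩

theorem abs_gaussianQInv_lt_sqrt {ε : ℝ} (hε : 0 < ε) (δ : ℝ) :
    |gaussianQInv δ| < √(gaussianQInv δ ^ 2 + 2 * ε) :=
  Real.lt_sqrt_of_sq_lt (by rw [sq_abs]; linarith)

theorem kappa_pos {ε : ℝ} (hε : 0 < ε) (δ : ℝ) : 0 < kappa δ ε := by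
  have := (abs_lt.1 (abs_gaussianQInv_lt_sqrt hε δ)).1
  exact mul_pos (by positivity) (by linarith)

/-- `kappa δ ε` is the larger root of 2εy² - 2Ky - 1, with K = `gaussianQInv δ`, so this quadratic
is nonnegative at `y`. -/
theorem gaussianQInv_le_of_kappa_le {ε δ y : ℝ} (hε : 0 < ε) (hy : kappa δ ε ≤ y) :
    gaussianQInv δ ≤ ε * y - 1 / (2 * y) := by
  have hy0 : 0 < y := (kappa_pos hε δ).trans_le hy
  have hlt := abs_lt.1 (abs_gaussianQInv_lt_sqrt hε δ)
  have hsq := Real.sq_sqrt (show 0 ≤ gaussianQInv δ ^ 2 + 2 * ε by positivity)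
  rw [kappa, one_div, inv_mul_le_iff₀ (by positivity)] at hy
  set K := gaussianQInv δ
  set R := √(K ^ 2 + 2 * ε)
  have h : K * (2 * y) + 1 ≤ ε * y * (2 * y) := by
    have : 0 ≤ (2 * ε * y - (K + R)) * (2 * ε * y - (K - R)) :=
      mul_nonneg (by linarith) (by nlinarith)
    have : 0 ≤ (2 * ε) * (ε * y * (2 * y) - (K * (2 * y) + 1)) := by nlinarith
    have := nonneg_of_mul_nonneg_right this (by positivity)
    linarith
  have : K + 1 / (2 * y) ≤ ε * y := by
    rw [← mul_le_mul_iff_of_pos_right (show 0 < 2 * y by positivity), add_mul,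
      one_div_mul_cancel (by positivity)]
    exact h
  linarith

theorem gaussianReal_Ioi (m : ℝ) {σ : ℝ≥0} (hσ : 0 < σ) (x : ℝ) :
    gaussianReal m (σ ^ 2) (Set.Ioi x) = ENNReal.ofReal (gaussianQ ((x - m) / σ)) := by
  have hσ' : (0 : ℝ) < σ := hσ
  have h1 := gaussianReal_map_const_mul (μ := 0) (v := 1) (σ : ℝ)
  have h2 := gaussianReal_map_add_const (μ := 0) (v := σ ^ 2) m
  have h3 : (NNReal.mk ((σ : ℝ) ^ 2) (sq_nonneg _) : ℝ≥0) = σ ^ 2 := by ext; simp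
  rw [h3, mul_zero, mul_one] at h1
  rw [zero_add, ← h1, Measure.map_map (by fun_prop) (by fun_prop)] at h2
  rw [ofReal_gaussianQ, ← h2, Measure.map_apply (by fun_prop) measurableSet_Ioi]
  congr 1
  ext z
  simp only [Set.mem_preimage, Function.comp_apply, Set.mem_Ioi, div_lt_iff₀ hσ']
  constructor <;> intro h <;> linarith

theorem gaussianPDF_le_exp_mul {ε D x : ℝ} {σ : ℝ≥0} (hσ : 0 < σ) (hD : 0 < D)
    (hx : x ≤ ε * σ ^ 2 / D + D / 2) :
    gaussianPDF D (σ ^ 2) x ≤ ENNReal.ofReal (Real.exp ε) * gaussianPDF 0 (σ ^ 2) x := by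
  have hσ' : (0 : ℝ) < σ := hσ
  rw [gaussianPDF, gaussianPDF, ← ENNReal.ofReal_mul (Real.exp_nonneg _)]
  refine ENNReal.ofReal_le_ofReal ?_
  rw [gaussianPDFReal, gaussianPDFReal, mul_left_comm, ← Real.exp_add]
  gcongr
  have h : x * D ≤ ε * σ ^ 2 + D / 2 * D := by
    have := mul_le_mul_of_nonneg_right hx hD.le
    rwa [add_mul, div_mul_cancel₀ _ hD.ne'] at this
  push_cast
  rw [← mul_le_mul_iff_of_pos_right (show (0 : ℝ) < 2 * σ ^ 2 by positivity), add_mul,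
    div_mul_cancel₀ _ (by positivity), div_mul_cancel₀ _ (by positivity)]
  nlinarith

/-- The log-density ratio is affine in x and equals ε at `x₀`; the excess measure is the tail beyond
`x₀`, of mass Q(εσ/D - D/(2σ)). -/
theorem gaussianReal_le_exp_smul_add {ε δ D : ℝ} {σ : ℝ≥0} (hε : 0 < ε) (hδ₀ : 0 < δ)
    (hδ₁ : δ < 1) (hD : 0 < D) (hσ : kappa δ ε * D ≤ σ) :
    ∃ μ : Measure ℝ, μ Set.univ ≤ ENNReal.ofReal δ ∧
      gaussianReal D (σ ^ 2) ≤ ENNReal.ofReal (Real.exp ε) • gaussianReal 0 (σ ^ 2) + μ := by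
  have hσ' : (0 : ℝ) < σ := (mul_pos (kappa_pos hε δ) hD).trans_le hσ
  have hσ0 : 0 < σ := hσ'
  have hv : σ ^ 2 ≠ 0 := (pow_pos hσ0 2).ne'
  set x₀ : ℝ := ε * σ ^ 2 / D + D / 2 with hx₀
  refine ⟨(gaussianReal D (σ ^ 2)).restrict (Set.Ioi x₀), ?_, ?_⟩
  · rw [Measure.restrict_apply_univ, gaussianReal_Ioi _ hσ0]
    refine ENNReal.ofReal_le_ofReal ?_
    rw [← gaussianQ_gaussianQInv hδ₀ hδ₁]
    refine gaussianQ_antitone ?_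
    refine (gaussianQInv_le_of_kappa_le hε ((le_div_iff₀ hD).2 hσ)).trans_eq ?_
    rw [hx₀]
    field_simp
    ring
  · refine (Measure.restrict_compl_add_restrict (measurableSet_Ioi (a := x₀))).ge.trans
      (add_le_add_left ?_ _)
    refine Measure.le_iff.2 fun S hS => ?_
    rw [Measure.restrict_apply hS, Measure.smul_apply, smul_eq_mul,
      gaussianReal_apply _ hv, gaussianReal_apply _ hv,
      ← lintegral_const_mul _ (measurable_gaussianPDF _ _)]
    refine (setLIntegral_mono (by fun_prop) fun x hx =>
      gaussianPDF_le_exp_mul hσ0 hD (not_lt.1 hx.2)).trans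
      (lintegral_mono_set Set.inter_subset_left)

end

/-! ### Reduction to one dimension; from cylinders to all measurable sets. -/

section
open DynamicPrivacy
open scoped RealInnerProductSpace symmDiff

section Hilbert

variable {H : Type*} [NormedAddCommGroup H] [InnerProductSpace ℝ H] [MeasurableSpace H]
  [BorelSpace H] [SecondCountableTopology H]

theorem charFun_map_smul_const (μ : Measure ℝ) (e t : H) :
    charFun (μ.map fun x : ℝ => x • e) t = charFun μ ⟪e, t⟫ := by
  rw [charFun_apply, charFun_apply, integral_map (by fun_prop) (by fun_prop)]
  simp [inner_smul_left, mul_comm]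

theorem charFun_map_sub_inner_smul (γ : Measure H) (e t : H) :
    charFun (γ.map fun y => y - ⟪e, y⟫ • e) t = charFun γ (t - ⟪e, t⟫ • e) := by
  rw [charFun_apply, charFun_apply, integral_map (by fun_prop) (by fun_prop)]
  congr with y
  rw [inner_sub_left, inner_sub_right, inner_smul_left, inner_smul_right, real_inner_comm y e]
  simp [mul_comm]

/-- An isotropic Gaussian measure translated along a unit vector `e` splits as the convolution of a
one-dimensional Gaussian measure along `e` and the image under the orthogonal projection. -/
theorem map_smul_add_eq_conv [CompleteSpace H] {γ : Measure H} [IsProbabilityMeasure γ] {σ : ℝ≥0}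
    (hγ : ∀ t, charFun γ t = Complex.exp (-((σ : ℝ) ^ 2 * ‖t‖ ^ 2 / 2 : ℝ)))
    {e : H} (he : ‖e‖ = 1) (D : ℝ) :
    γ.map (D • e + ·) = ((gaussianReal D (σ ^ 2)).map fun x => x • e) ∗
      (γ.map fun y => y - ⟪e, y⟫ • e) := by
  have : IsProbabilityMeasure (γ.map (D • e + ·)) :=
    Measure.isProbabilityMeasure_map (by fun_prop)
  have : IsProbabilityMeasure (γ.map fun y => y - ⟪e, y⟫ • e) :=
    Measure.isProbabilityMeasure_map (by fun_prop)
  have : IsProbabilityMeasure ((gaussianReal D (σ ^ 2)).map fun x => x • e) :=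
    Measure.isProbabilityMeasure_map (by fun_prop)
  refine Measure.ext_of_charFun (funext fun t => ?_)
  -- Pythagoras: the exponents along and across `e` add up to the full one.
  have hn : ‖t - ⟪e, t⟫ • e‖ ^ 2 = ‖t‖ ^ 2 - ⟪e, t⟫ ^ 2 := by
    rw [norm_sub_sq_real, norm_smul, he, inner_smul_right, real_inner_comm e t, mul_one,
      Real.norm_eq_abs, sq_abs]
    ring
  rw [charFun_conv, charFun_map_const_add, charFun_map_smul_const, charFun_map_sub_inner_smul,
    charFun_gaussianReal, hγ, hγ, hn, ← Complex.exp_add, ← Complex.exp_add, inner_smul_left]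
  congr 1
  push_cast
  simp only [conj_trivial]
  ring

/-- Both laws are convolutions with the same transverse probability measure `ρ`, and convolving with
`ρ` preserves inequalities and total mass. -/
theorem map_add_le_exp_smul_add [CompleteSpace H] {γ : Measure H} [IsProbabilityMeasure γ]
    {σ : ℝ≥0} (hγ : ∀ t, charFun γ t = Complex.exp (-((σ : ℝ) ^ 2 * ‖t‖ ^ 2 / 2 : ℝ)))
    {ε δ : ℝ} (hε : 0 < ε) (hδ₀ : 0 < δ) (hδ₁ : δ < 1) {v : H} (hv : kappa δ ε * ‖v‖ ≤ σ) :
    ∃ μ : Measure H, μ Set.univ ≤ ENNReal.ofReal δ ∧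
      γ.map (v + ·) ≤ ENNReal.ofReal (Real.exp ε) • γ + μ := by
  -- Without a shift there is no direction to project on; this case also covers σ = 0.
  rcases eq_or_ne v 0 with rfl | hv0
  · refine ⟨0, by simp, ?_⟩
    simp only [zero_add, Measure.map_id', add_zero]
    refine Measure.le_iff.2 fun S _ => ?_
    rw [Measure.smul_apply, smul_eq_mul]
    refine le_mul_of_one_le_left' ?_
    rw [ENNReal.one_le_ofReal]
    exact Real.one_le_exp hε.le
  obtain ⟨μ, hμ, hle⟩ := gaussianReal_le_exp_smul_add hε hδ₀ hδ₁ (norm_pos_iff.2 hv0) hv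
  have : IsFiniteMeasure μ := ⟨hμ.trans_lt ENNReal.ofReal_lt_top⟩
  set e : H := ‖v‖⁻¹ • v with he
  have he1 : ‖e‖ = 1 := norm_smul_inv_norm hv0
  have hve : ‖v‖ • e = v := by rw [he, smul_inv_smul₀ (norm_ne_zero_iff.2 hv0)]
  have hv' := map_smul_add_eq_conv hγ he1 ‖v‖
  have h0 := map_smul_add_eq_conv hγ he1 0
  rw [hve] at hv'
  simp only [zero_smul, zero_add, Measure.map_id'] at h0
  set ρ := γ.map fun y => y - ⟪e, y⟫ • e
  have : IsProbabilityMeasure ρ := Measure.isProbabilityMeasure_map (by fun_prop)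
  have hm : Measurable fun x : ℝ => x • e := by fun_prop
  refine ⟨μ.map (fun x => x • e) ∗ ρ, ?_, ?_⟩
  · rw [Measure.conv, Measure.map_apply (by fun_prop) .univ, Set.preimage_univ, ← Set.univ_prod_univ,
      Measure.prod_prod, measure_univ (μ := ρ), mul_one, Measure.map_apply hm .univ]
    exact hμ
  · conv_rhs => rw [h0]
    rw [hv', ← Measure.conv_smul_left, ← Measure.add_conv, ← Measure.map_smul, ← Measure.map_add _ _ hm]
    exact Measure.map_mono (Measure.prod_mono (Measure.map_mono hle hm) le_rfl) (by fun_prop)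

end Hilbert

/-- μ is the positive part of `m₁ - c • m₂`; its mass is bounded by the hypothesis applied to the
positive Hahn set. -/
theorem exists_measure_le_smul_add {X : Type*} [MeasurableSpace X] {m₁ m₂ : Measure X}
    [IsFiniteMeasure m₁] [IsFiniteMeasure m₂] {c δ : ℝ≥0∞} (hc : c ≠ ∞)
    (h : ∀ S, MeasurableSet S → m₁ S ≤ c * m₂ S + δ) :
    ∃ μ : Measure X, μ Set.univ ≤ δ ∧ m₁ ≤ c • m₂ + μ := by
  have : IsFiniteMeasure (c • m₂) := Measure.smul_finite _ hc
  obtain ⟨s, hs, h1, h2⟩ := hahn_decomposition m₁ (c • m₂)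
  have hle : (c • m₂).restrict s ≤ m₁.restrict s := Measure.le_iff.2 fun t ht => by
    rw [Measure.restrict_apply ht, Measure.restrict_apply ht]
    exact h1 _ (ht.inter hs) Set.inter_subset_right
  have hle' : m₁.restrict sᶜ ≤ (c • m₂).restrict sᶜ := Measure.le_iff.2 fun t ht => by
    rw [Measure.restrict_apply ht, Measure.restrict_apply ht]
    exact h2 _ (ht.inter hs.compl) Set.inter_subset_right
  refine ⟨m₁.restrict s - (c • m₂).restrict s, ?_, ?_⟩
  · rw [Measure.sub_apply .univ hle, Measure.restrict_apply_univ, Measure.restrict_apply_univ,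
      tsub_le_iff_left]
    exact h s hs
  · calc m₁ = m₁.restrict sᶜ + m₁.restrict s := by
          rw [add_comm, Measure.restrict_add_restrict_compl hs]
      _ ≤ (c • m₂).restrict sᶜ + m₁.restrict s := by gcongr
      _ = (c • m₂).restrict sᶜ + (c • m₂).restrict s
          + (m₁.restrict s - (c • m₂).restrict s) := by
          rw [add_assoc, add_comm ((c • m₂).restrict s), Measure.sub_add_cancel_of_le hle]
      _ = _ := by rw [add_comm ((c • m₂).restrict sᶜ), Measure.restrict_add_restrict_compl hs]

theorem measure_le_mul_add_of_dense {X : Type*} [MeasurableSpace X] {m₁ m₂ : Measure X}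
    [IsFiniteMeasure m₁] [IsFiniteMeasure m₂] {c δ : ℝ≥0∞} (hc : c ≠ ∞) {𝒜 : Set (Set X)}
    (h𝒜 : (m₁ + m₂).MeasureDense 𝒜) (h : ∀ S ∈ 𝒜, m₁ S ≤ c * m₂ S + δ) {S : Set X}
    (hS : MeasurableSet S) : m₁ S ≤ c * m₂ S + δ := by
  refine ENNReal.le_of_forall_pos_le_add fun η hη _ => ?_
  lift c to ℝ≥0 using hc
  -- Replacing `S` by `t` costs at most (1 + c)(m₁ + m₂)(S ∆ t).
  have hη' : 0 < η / (1 + c) := by positivity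
  obtain ⟨t, ht, hlt⟩ := h𝒜.approx S hS (measure_ne_top _ _) (η / (1 + c) : ℝ≥0) hη'
  rw [ENNReal.ofReal_coe_nnreal, Measure.add_apply] at hlt
  have e1 : m₁ S ≤ m₁ t + m₁ (S ∆ t) := (measure_mono fun x hx => by
    by_cases hxt : x ∈ t
    exacts [Or.inl hxt, Or.inr (Or.inl ⟨hx, hxt⟩)]).trans (measure_union_le _ _)
  have e2 : m₂ t ≤ m₂ S + m₂ (S ∆ t) := (measure_mono fun x hx => by
    by_cases hxt : x ∈ S
    exacts [Or.inl hxt, Or.inr (Or.inr ⟨hx, hxt⟩)]).trans (measure_union_le _ _)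
  calc m₁ S ≤ m₁ t + m₁ (S ∆ t) := e1
    _ ≤ (c * m₂ t + δ) + m₁ (S ∆ t) := by gcongr; exact h t ht
    _ ≤ (c * (m₂ S + m₂ (S ∆ t)) + δ) + m₁ (S ∆ t) := by gcongr
    _ = (c * m₂ S + δ) + (c * m₂ (S ∆ t) + 1 * m₁ (S ∆ t)) := by ring
    _ ≤ (c * m₂ S + δ) + ((1 + c) * m₂ (S ∆ t) + (1 + c) * m₁ (S ∆ t)) := by
        gcongr
        · exact le_add_self
        · exact le_self_add
    _ = (c * m₂ S + δ) + (1 + c) * (m₁ (S ∆ t) + m₂ (S ∆ t)) := by ring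
    _ ≤ (c * m₂ S + δ) + (1 + c) * (η / (1 + c) : ℝ≥0) := by gcongr
    _ = (c * m₂ S + δ) + η := by
        congr 1
        have : (1 + c) * (η / (1 + c)) = η := mul_div_cancel₀ _ (by positivity)
        exact_mod_cast congrArg ((↑) : ℝ≥0 → ℝ≥0∞) this

theorem exists_measure_le_smul_add_of_cylinder {ι : Type*} {X : ι → Type*}
    [∀ i, MeasurableSpace (X i)] {m₁ m₂ : Measure (∀ i, X i)}
    [IsFiniteMeasure m₁] [IsFiniteMeasure m₂] {c δ : ℝ≥0∞} (hc : c ≠ ∞)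
    (h : ∀ (I : Finset ι) (S : Set (∀ i : I, X i)), MeasurableSet S →
      m₁ (cylinder I S) ≤ c * m₂ (cylinder I S) + δ) :
    ∃ μ : Measure (∀ i, X i), μ Set.univ ≤ δ ∧ m₁ ≤ c • m₂ + μ := by
  have halg : IsSetAlgebra (measurableCylinders X) := ⟨empty_mem_measurableCylinders _,
    fun _ => compl_mem_measurableCylinders, fun _ _ => union_mem_measurableCylinders⟩
  refine exists_measure_le_smul_add hc fun _ => measure_le_mul_add_of_dense hc
    (.of_generateFrom_isSetAlgebra_finite _ halg generateFrom_measurableCylinders.symm)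
    fun S hS => ?_
  obtain ⟨I, S, hS', rfl⟩ := (mem_measurableCylinders S).1 hS
  exact h I S hS'

end

/-! ### Incremental gain on finite windows, and the law of the noise there. -/

section
open DynamicPrivacy

section Norms

variable {𝕋 E F : Type*} [NormedAddCommGroup E] [NormedAddCommGroup F]

theorem lNorm_mono {p : ℝ≥0∞} {x y : 𝕋 → E} (h : ∀ t, ‖x t‖ₑ ≤ ‖y t‖ₑ) :
    lNorm p x ≤ lNorm p y := by
  unfold lNorm
  split_ifs
  · exact iSup_mono h
  · gcongr
    exact h _

theorem enorm_le_lNorm {p : ℝ≥0∞} (hp : p ≠ 0) (x : 𝕋 → E) (t : 𝕋) : ‖x t‖ₑ ≤ lNorm p x := by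
  unfold lNorm
  split_ifs with h
  · exact le_iSup (fun t => ‖x t‖ₑ) t
  · rw [one_div, ENNReal.le_rpow_inv_iff (ENNReal.toReal_pos hp h)]
    exact ENNReal.le_tsum (f := fun t => ‖x t‖ₑ ^ p.toReal) t

theorem enorm_toLp_restrict_le_lNorm (x : 𝕋 → E) (I : Finset 𝕋) :
    ‖(WithLp.toLp 2 fun t : I => x t : PiLp 2 fun _ : I => E)‖ₑ ≤ lNorm 2 x := by
  rw [lNorm, if_neg ENNReal.ofNat_ne_top, enorm_eq_nnnorm, PiLp.nnnorm_eq_sum (p := 2) ENNReal.ofNat_ne_top,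
    ENNReal.coe_rpow_of_nonneg _ (by simp), ENNReal.ofNNReal_finsetSum]
  gcongr
  simp_rw [ENNReal.coe_rpow_of_nonneg _ ENNReal.toReal_nonneg, ← enorm_eq_nnnorm]
  rw [Finset.sum_coe_sort I fun t => ‖x t‖ₑ ^ (2 : ℝ≥0∞).toReal]
  exact ENNReal.sum_le_tsum I

variable [LinearOrder 𝕋]

theorem lNorm_truncate_sub_le {p : ℝ≥0∞} (T : 𝕋) (x y : 𝕋 → E) :
    lNorm p (truncate T x - truncate T y) ≤ lNorm p (x - y) :=
  lNorm_mono fun t => by by_cases h : t ≤ T <;> simp [truncate, h]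

theorem lNorm_truncate_sub_le_incGain_mul {r q : ℝ≥0∞} (hr : r ≠ 0) (s : ℝ≥0∞) {b : ℝ≥0}
    (G : extSpace 𝕋 E r → extSpace 𝕋 F q) {u u' : extSpace 𝕋 E r}
    (h : lNorm r ((u : 𝕋 → E) - (u' : 𝕋 → E)) ≤ b) (T : 𝕋) (hs : s ≠ 0) :
    lNorm s (truncate T (G u : 𝕋 → F) - truncate T (G u' : 𝕋 → F)) ≤ incGain s G * b := by
  -- The gain may be ∞, so ∞ · 0 = 0 needs its own argument: the inputs coincide.
  rcases eq_or_ne b 0 with rfl | hb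
  · have : u = u' := Subtype.ext <| funext fun t => by
      have := (enorm_le_lNorm hr _ t).trans h
      simpa [sub_eq_zero] using this
    subst this
    simp only [sub_self, ENNReal.coe_zero, mul_zero, nonpos_iff_eq_zero]
    unfold lNorm
    split_ifs with hs'
    · simp
    · have := ENNReal.toReal_pos hs hs'
      simp [this]
  · rw [← ENNReal.div_le_iff (by simpa using hb) ENNReal.coe_ne_top]
    refine le_iInf₂ fun γ hγ => ?_
    rw [ENNReal.div_le_iff (by simpa using hb) ENNReal.coe_ne_top]
    refine (hγ T u u').trans ?_
    gcongr
    exact (lNorm_truncate_sub_le T _ _).trans h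

theorem enorm_toLp_sub_le_incGain_mul {r q : ℝ≥0∞} (hr : r ≠ 0) {b : ℝ≥0}
    (G : extSpace 𝕋 E r → extSpace 𝕋 F q) {u u' : extSpace 𝕋 E r}
    (h : lNorm r ((u : 𝕋 → E) - (u' : 𝕋 → E)) ≤ b) (I : Finset 𝕋) :
    ‖(WithLp.toLp 2 fun t : I => (G u).1 t - (G u').1 t : PiLp 2 fun _ : I => F)‖ₑ ≤
      incGain 2 G * b := by
  rcases I.eq_empty_or_nonempty with rfl | hI
  · rw [Subsingleton.elim (WithLp.toLp 2 _ : PiLp 2 fun _ : (∅ : Finset 𝕋) => F) 0]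
    simp
  -- Truncating at the last time of `I` leaves the coordinates in `I` unchanged.
  · refine le_trans ?_ (lNorm_truncate_sub_le_incGain_mul hr 2 G h (I.max' hI) two_ne_zero)
    refine Eq.trans_le ?_ (enorm_toLp_restrict_le_lNorm _ I)
    congr 2
    funext t
    simp [truncate, I.le_max' t t.2]

end Norms

theorem DynamicPrivacy.IsWhiteGaussianNoise.charFun_map_toLp {Ω 𝕋 : Type*} [MeasurableSpace Ω]
    {P : Measure Ω} [IsProbabilityMeasure P] {k : ℕ} {σ : ℝ≥0}
    {w : 𝕋 → Ω → EuclideanSpace ℝ (Fin k)} (hw : IsWhiteGaussianNoise P σ w) (I : Finset 𝕋)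
    (ξ : PiLp 2 fun _ : I => EuclideanSpace ℝ (Fin k)) :
    charFun (P.map fun ω => WithLp.toLp 2 fun t : I => w t ω) ξ =
      Complex.exp (-((σ : ℝ) ^ 2 * ‖ξ‖ ^ 2 / 2 : ℝ)) := by
  have hpos : ((σ : ℝ) ^ 2 • (1 : Matrix (Fin k) (Fin k) ℝ)).PosSemidef :=
    Matrix.PosSemidef.one.smul (sq_nonneg _)
  have hind : iIndepFun (fun (t : I) ω => w t ω) P := hw.indep.precomp Subtype.val_injective
  rw [(iIndepFun_iff_charFun_pi fun t : I => (hw.measurable t).aemeasurable).1 hind ξ]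
  have (t : I) : charFun (P.map (w t)) (ξ t) =
      Complex.exp (-((σ : ℝ) ^ 2 * ‖ξ t‖ ^ 2 / 2 : ℝ)) := by
    rw [hw.law, charFun_multivariateGaussian hpos, EuclideanSpace.real_norm_sq_eq]
    simp [Matrix.smul_mulVec, dotProduct, pow_two, Finset.mul_sum, mul_left_comm]
  rw [Finset.prod_congr rfl fun t _ => this t, ← Complex.exp_sum, PiLp.norm_sq_eq_of_L2]
  congr 1
  rw [Finset.sum_neg_distrib, ← Complex.ofReal_sum, ← Finset.sum_div, ← Finset.mul_sum]

theorem DynamicPrivacy.IsWhiteGaussianNoise.measure_add_preimage_le {Ω 𝕋 : Type*}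
    [MeasurableSpace Ω] {P : Measure Ω} [IsProbabilityMeasure P] {k : ℕ} {σ : ℝ≥0}
    {w : 𝕋 → Ω → EuclideanSpace ℝ (Fin k)} (hw : IsWhiteGaussianNoise P σ w)
    {ε δ : ℝ} (hε : 0 < ε) (hδ₀ : 0 < δ) (hδ₁ : δ < 1) {I : Finset 𝕋}
    (y y' : I → EuclideanSpace ℝ (Fin k)) (h : kappa δ ε * ‖WithLp.toLp 2 (y - y')‖ ≤ σ)
    {S : Set (I → EuclideanSpace ℝ (Fin k))} (hS : MeasurableSet S) :
    P ((fun ω t => y t + w t ω) ⁻¹' S) ≤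
      ENNReal.ofReal (Real.exp ε) * P ((fun ω t => y' t + w t ω) ⁻¹' S) + ENNReal.ofReal δ := by
  have hm : Measurable fun ω => WithLp.toLp 2 fun t : I => w t ω :=
    (WithLp.measurable_toLp 2 _).comp (measurable_pi_lambda _ fun t => hw.measurable t)
  have : IsProbabilityMeasure (P.map fun ω => WithLp.toLp 2 fun t : I => w t ω) :=
    Measure.isProbabilityMeasure_map hm.aemeasurable
  obtain ⟨μ, hμ, hle⟩ := map_add_le_exp_smul_add (hw.charFun_map_toLp I) hε hδ₀ hδ₁ h
  -- Translating by `y'` centres the second law and leaves the shift `y - y'` in the first.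
  set S' : Set (PiLp 2 fun _ : I => EuclideanSpace ℝ (Fin k)) := {z | y' + WithLp.ofLp z ∈ S}
  have hS' : MeasurableSet S' :=
    ((WithLp.measurable_ofLp 2 _).const_add y') hS
  have := Measure.le_iff.1 hle S' hS'
  rw [Measure.map_map (by fun_prop) hm, Measure.map_apply (by fun_prop) hS', Measure.add_apply,
    Measure.smul_apply, Measure.map_apply hm hS', smul_eq_mul] at this
  have hpre : (fun ω t => y t + w t ω) ⁻¹' S =
      ((WithLp.toLp 2 (y - y') + ·) ∘ fun ω => WithLp.toLp 2 fun t : I => w t ω) ⁻¹' S' := by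
    ext ω
    change _ ∈ S ↔ y' + ((y - y') + fun t : I => w t ω) ∈ S
    rw [← add_assoc, add_sub_cancel]
    rfl
  rw [hpre]
  refine this.trans ?_
  gcongr
  · rfl
  · exact (measure_mono (Set.subset_univ _)).trans hμ

end

open DynamicPrivacy in
theorem mainTheorem3 {Ω : Type*} [MeasurableSpace Ω] (P : Measure Ω) [IsProbabilityMeasure P]
    {𝕋 : Type*} [LinearOrder 𝕋] [LocallyFiniteOrder 𝕋]
    {n k : ℕ} {E : Fin n → Type*} [∀ i, NormedAddCommGroup (E i)] [∀ i, NormedSpace ℝ (E i)]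
    (r : Fin n → ℝ≥0∞) (hr : ∀ i, 1 ≤ r i) (s : ℝ≥0∞) (hs : 1 ≤ s)
    (b : Fin n → ℝ≥0)
    (G : ∀ i, extSpace 𝕋 (E i) (r i) → extSpace 𝕋 (EuclideanSpace ℝ (Fin k)) s)
    (hG : ∀ i, IsCausal (G i))
    (ε δ : ℝ) (hε : 0 < ε) (hδ₀ : 0 < δ) (hδ₁ : δ < 1)
    (σ : ℝ≥0) (w : 𝕋 → Ω → EuclideanSpace ℝ (Fin k)) (hw : IsWhiteGaussianNoise P σ w)
    (hσ : ENNReal.ofReal (kappa δ ε) * (⨆ i, incGain 2 (G i) * (b i : ℝ≥0∞)) ≤ σ) :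
    IsDifferentiallyPrivate P (SignalAdj (r := r) b) ε δ (gaussianMechanism G w) := by
  have hmeas (u) : Measurable (gaussianMechanism G w u) :=
    measurable_pi_lambda _ fun t => (hw.measurable t).const_add _
  refine ⟨hmeas, fun u u' ⟨i, hi, hne⟩ => ?_⟩
  have hfin (u) : IsFiniteMeasure (P.map (gaussianMechanism G w u)) :=
    Measure.isFiniteMeasure_map _ _
  suffices h : ∀ (I : Finset 𝕋) (S : Set (I → EuclideanSpace ℝ (Fin k))), MeasurableSet S →
      P.map (gaussianMechanism G w u) (cylinder I S) ≤ ENNReal.ofReal (Real.exp ε) *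
        P.map (gaussianMechanism G w u') (cylinder I S) + ENNReal.ofReal δ by
    obtain ⟨μ, hμ, hle⟩ := exists_measure_le_smul_add_of_cylinder
      (X := fun _ : 𝕋 => EuclideanSpace ℝ (Fin k)) ENNReal.ofReal_ne_top h
    refine ⟨μ, hμ, fun S hS => ?_⟩
    have := Measure.le_iff.1 hle S hS
    rwa [Measure.add_apply, Measure.smul_apply, Measure.map_apply (hmeas _) hS,
      Measure.map_apply (hmeas _) hS, smul_eq_mul] at this
  intro I S hS
  rw [Measure.map_apply (hmeas _) hS.cylinder, Measure.map_apply (hmeas _) hS.cylinder]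
  refine hw.measure_add_preimage_le hε hδ₀ hδ₁ (fun t : I => (∑ j, G j (u j)).1 t)
    (fun t : I => (∑ j, G j (u' j)).1 t) ?_ hS
  -- All terms except the one of participant `i` cancel.
  have hdiff : (∑ j, G j (u j)) - ∑ j, G j (u' j) = G i (u i) - G i (u' i) := by
    rw [← Finset.sum_sub_distrib, Finset.sum_eq_single i (fun j _ hj => by rw [hne j hj, sub_self])
      fun h => absurd (Finset.mem_univ i) h]
  have hdiff' : ((fun t : I => (∑ j, G j (u j)).1 t) - fun t : I => (∑ j, G j (u' j)).1 t) =
      fun t : I => (G i (u i)).1 t - (G i (u' i)).1 t := funext fun t =>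
    congrFun (congrArg Subtype.val hdiff) (t : 𝕋)
  rw [hdiff']
  have hb := enorm_toLp_sub_le_incGain_mul (one_pos.trans_le (hr i)).ne' (G i) hi I
  have : ENNReal.ofReal (kappa δ ε) * ‖WithLp.toLp 2
      fun t : I => (G i (u i)).1 t - (G i (u' i)).1 t‖ₑ ≤ σ :=
    le_trans (by gcongr; exact hb.trans (le_iSup (fun i => incGain 2 (G i) * (b i : ℝ≥0∞)) i)) hσ
  rw [← ofReal_norm, ← ENNReal.ofReal_mul (kappa_pos hε δ).le,
    ← ENNReal.ofReal_coe_nnreal] at this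
  exact (ENNReal.ofReal_le_ofReal_iff σ.2).1 this
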